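/- **Lemma 2.1.** Let $[n]=\{1,\dots,n\}$, and for a finite set $A$ of positive integers let $s(A)=\sum_{a\in A}1/a$. Let $h(p)=-p\log_2p-(1-p)\log_2(1-p)$ for $0<p<1$ and $h(0)=h(1)=0$. Given $x>0$ and $n$, choose $p_1,\dots,p_n\in[0,1]$ so as to maximize $\sum_{m=1}^n h(p_m)$ subject to $\sum_{m=1}^n p_m/m\le x$. Let $P(x)$ be the joint distribution of independent random variables $Y_1,\dots,Y_n$, where $Y_m=1$ with probability $p_m$ and $Y_m=0$ otherwise, and let $H(P(x))$ be its Shannon entropy in bits. Then for every $\varepsilon>0$, every $n$ and every $x\in(0,(1-\varepsilon)(\ln n)/2)$, the number of $A\subseteq[n]$ with $s(A)\le x$ is at most $2^{H(P(x))}$. Furthermore, there are absolute constants $C,K>0$ and numbers $c_{x,n}>0$ such that, for every $\varepsilon>0$, every $n$ and every $x\in(0,(1-\varepsilon)(\ln n)/2)$, we have $C^{-1}e^{-2x}\le c_{x,n}\le Ce^{-2x}$ and, for every $U\subseteq[n]$, the number of $A\subseteq U$ with $s(A)\le x$ is at least $$2^{H(P(x))-(n-|U|)-K\sqrt{n/c_{x,n}}}.$$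 -/

import Mathlib

open scoped unitInterval

noncomputable section

namespace EgyptianEntropy

/-- The reciprocal sum `s(A) = ∑_{a ∈ A} 1/a`. -/
def recipSum (A : Finset ℕ) : ℝ := ∑ a ∈ A, 1 / (a : ℝ)

/-- The number of subsets `A ⊆ U` with `s(A) ≤ x`. -/
def countSubsets (U : Finset ℕ) (x : ℝ) : ℕ :=
  (U.powerset.filter fun A => recipSum A ≤ x).card

/-- Binary entropy in bits, `h(p) = -p log₂ p - (1-p) log₂ (1-p)`. Since `Real.logb 2 0 = 0`
and `Real.logb 2 1 = 0`, this formula gives `h(0) = h(1) = 0`. -/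
def h (p : ℝ) : ℝ := -p * Real.logb 2 p - (1 - p) * Real.logb 2 (1 - p)

/-- The index set `[n] = {1, …, n}` as a type. -/
abbrev Idx (n : ℕ) : Type := ↥(Finset.Icc 1 n)

/-- The vectors `(p_1, …, p_n) ∈ [0,1]^n` with `∑ p_m / m ≤ x`. -/
def feasible (n : ℕ) (x : ℝ) : Set (Idx n → I) :=
  {p | ∑ m, (p m : ℝ) / ((m : ℕ) : ℝ) ≤ x}

/-- `p` maximizes `∑ h(p_m)` over `[0,1]^n` subject to `∑ p_m / m ≤ x`. -/
def IsEntropyMaximizer (n : ℕ) (x : ℝ) (p : Idx n → I) : Prop :=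
  p ∈ feasible n x ∧ IsMaxOn (fun q : Idx n → I => ∑ m, h (q m)) (feasible n x) p

theorem h_eq_binEntropy (p : ℝ) : h p = Real.binEntropy p / Real.log 2 := by
  simp only [h, Real.logb, Real.binEntropy, Real.log_inv]
  ring

theorem exists_isEntropyMaximizer (n : ℕ) {x : ℝ} (hx : 0 ≤ x) :
    ∃ p, IsEntropyMaximizer n x p := by
  have hcl : IsClosed (feasible n x) := by
    unfold feasible
    exact isClosed_le (by fun_prop) continuous_const
  have hne : (feasible n x).Nonempty := ⟨fun _ => 0, by simpa [feasible] using hx⟩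
  have hc : Continuous (fun q : Idx n → I => ∑ m, h (q m)) := by
    simp only [h_eq_binEntropy]
    refine continuous_finsetSum _ fun m _ => ?_
    exact (Real.binEntropy_continuous.comp
      (continuous_subtype_val.comp (continuous_apply m))).div_const _
  obtain ⟨p, hp, hmax⟩ := hcl.isCompact.exists_isMaxOn hne hc.continuousOn
  exact ⟨p, hp, hmax⟩

/-- A vector `(p_1, …, p_n)` chosen to maximize `∑ h(p_m)` subject to `∑ p_m / m ≤ x`. -/
def optProb (n : ℕ) (x : ℝ) : Idx n → I := Classical.epsilon (IsEntropyMaximizer n x)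

theorem optProb_spec (n : ℕ) {x : ℝ} (hx : 0 ≤ x) : IsEntropyMaximizer n x (optProb n x) :=
  Classical.epsilon_spec (exists_isEntropyMaximizer n hx)

/-- The joint law `P(x)` of independent `Y_1, …, Y_n`, where `Y_m = true` with probability `p_m`
and `Y_m = false` otherwise, for the maximizing vector `(p_1, …, p_n)`. -/
def P (n : ℕ) (x : ℝ) : MeasureTheory.Measure (Idx n → Bool) :=
  MeasureTheory.Measure.pi fun m => ProbabilityTheory.bernoulliMeasure true false (optProb n x m)

/-- The Shannon entropy, in bits, of a distribution on a finite type (`0 log₂ 0 = 0`). -/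
def shannonEntropy {α : Type*} [Fintype α] [MeasurableSpace α]
    (μ : MeasureTheory.Measure α) : ℝ :=
  -∑ y, μ.real {y} * Real.logb 2 (μ.real {y})

end EgyptianEntropy

end

open scoped unitInterval

noncomputable section

namespace EgyptianEntropy

/-! ### Product weights on the cube: Chebyshev, typical points, subadditivity of entropy -/

section ProductWeights

variable {ι : Type*} [Fintype ι] [DecidableEq ι]

/-! Upper bound: for a uniformly random admissible set, the probabilities `q_m` that it contains `m`
satisfy the constraint, since every admissible set does. Subadditivity of entropy
(`card_le_exp_sum_binEntropy`) bounds the log of the count by the sum of the entropies of the `q_m`,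
hence by the maximum.

Lower bound: stationarity in the constrained problem suggests the profile `p_m = 1/(1 + e^{l/m})`,
with `l > 0` tuned so that the mean reciprocal sum is `x`. Gibbs' inequality shows that its entropy
`H` is at least that of the chosen maximizer, so neither uniqueness nor a formula for the maximizer
is needed (`sum_binEntropy_optProb_le`).

Let `V = ∑ p_m/m²`, which bounds the variance of the random reciprocal sum. Scaling the profile by
`1 - 2√V/x` puts the mean `2√V` below `x` and, by concavity, costs at most `2√V·H/x` of entropy.
Chebyshev, applied to the reciprocal sum and to the log-likelihood, leaves mass at least `1/2` on
admissible points each of small mass, so there are many of them (`exp_le_card_of_variance`).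

The total loss is `O(√(n e^{2x}))` because `H/x ≤ 2n + l` and `(2n + l)² V = O(n e^{2x})`. The
latter rests on `n/⌈l⌉ = O(e^{2x})` when `⌈l⌉ ≤ n`: the indices above `l` alone contribute about
half of `log (n/l)` to `x`. Restricting from `[n]` to `U` divides the count by at most `2^{n-|U|}`.
-/

theorem sum_prod_apply (g : ι → Bool → ℝ) :
    ∑ y : ι → Bool, ∏ i, g i (y i) = ∏ i, ∑ b, g i b := by
  rw [Finset.prod_univ_sum, Fintype.piFinset_univ]

theorem sum_prod_mul_apply {w : ι → Bool → ℝ} (hw : ∀ i, ∑ b, w i b = 1) (j : ι)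
    (f : Bool → ℝ) :
    ∑ y : ι → Bool, (∏ i, w i (y i)) * f (y j) = ∑ b, w j b * f b := by
  have h := sum_prod_apply fun i b => w i b * if i = j then f b else 1
  simp only [Finset.prod_mul_distrib, Finset.prod_ite_eq', Finset.mem_univ, if_true] at h
  rw [h, Finset.prod_eq_single j]
  · simp
  · intro i _ hij
    simpa [hij] using hw i
  · simp

theorem sum_prod_mul_apply_mul_apply {w : ι → Bool → ℝ} (hw : ∀ i, ∑ b, w i b = 1) {j k : ι}
    (hjk : j ≠ k) (f g : Bool → ℝ) :
    ∑ y : ι → Bool, (∏ i, w i (y i)) * (f (y j) * g (y k))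
      = (∑ b, w j b * f b) * ∑ b, w k b * g b := by
  have h := sum_prod_apply fun i b =>
    w i b * ((if i = j then f b else 1) * if i = k then g b else 1)
  simp only [Finset.prod_mul_distrib, Finset.prod_ite_eq', Finset.mem_univ, if_true] at h
  rw [h, ← Finset.mul_prod_erase _ _ (Finset.mem_univ j),
    ← Finset.mul_prod_erase _ _ (Finset.mem_erase.2 ⟨hjk.symm, Finset.mem_univ k⟩),
    Finset.prod_eq_one]
  · simp [hjk, hjk.symm]
  · intro i hi
    simp only [Finset.mem_erase] at hi
    simpa [hi.1, hi.2.1] using hw i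

theorem sum_prod_mul_sum {w : ι → Bool → ℝ} (hw : ∀ i, ∑ b, w i b = 1) (f : ι → Bool → ℝ) :
    ∑ y : ι → Bool, (∏ i, w i (y i)) * ∑ j, f j (y j) = ∑ j, ∑ b, w j b * f j b := by
  simp_rw [Finset.mul_sum]
  rw [Finset.sum_comm]
  exact Finset.sum_congr rfl fun j _ => sum_prod_mul_apply hw j (f j)

/-- Variances of independent variables add: with centred summands, the cross terms factor and
vanish. -/
theorem sum_prod_mul_sq_sum {w : ι → Bool → ℝ} (hw : ∀ i, ∑ b, w i b = 1) {f : ι → Bool → ℝ}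
    (hf : ∀ i, ∑ b, w i b * f i b = 0) :
    ∑ y : ι → Bool, (∏ i, w i (y i)) * (∑ j, f j (y j)) ^ 2 = ∑ j, ∑ b, w j b * f j b ^ 2 := by
  simp_rw [sq (∑ j, f j _), Finset.sum_mul_sum, Finset.mul_sum]
  rw [Finset.sum_comm]
  refine Finset.sum_congr rfl fun j _ => ?_
  rw [Finset.sum_comm, Finset.sum_eq_single j]
  · simp_rw [← sq]
    exact sum_prod_mul_apply hw j fun b => f j b ^ 2
  · intro k _ hk
    rw [sum_prod_mul_apply_mul_apply hw hk.symm, hf j, zero_mul]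
  · simp

/-- Chebyshev's inequality, with each variance relaxed to a raw second moment. -/
theorem sq_mul_sum_prod_le {w : ι → Bool → ℝ} (hw0 : ∀ i b, 0 ≤ w i b)
    (hw : ∀ i, ∑ b, w i b = 1) (f : ι → Bool → ℝ) {t : ℝ} (ht : 0 ≤ t) :
    t ^ 2 * ∑ y : ι → Bool with t ≤ |∑ j, f j (y j) - ∑ j, ∑ b, w j b * f j b|, ∏ i, w i (y i)
      ≤ ∑ j, ∑ b, w j b * f j b ^ 2 := by
  set e : ι → ℝ := fun j => ∑ b, w j b * f j b with he
  have hQ : ∀ y : ι → Bool, 0 ≤ ∏ i, w i (y i) := fun y => Finset.prod_nonneg fun i _ => hw0 i _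
  have hvar := sum_prod_mul_sq_sum hw (f := fun j b => f j b - e j) (fun i => by
    have h1 := hw i
    simp only [he, Fintype.sum_bool] at h1 ⊢
    linear_combination (-(w i true * f i true) - w i false * f i false) * h1)
  calc t ^ 2 * ∑ y : ι → Bool with t ≤ |∑ j, f j (y j) - ∑ j, e j|, ∏ i, w i (y i)
      ≤ ∑ y : ι → Bool with t ≤ |∑ j, f j (y j) - ∑ j, e j|,
          (∏ i, w i (y i)) * (∑ j, (f j (y j) - e j)) ^ 2 := by
        rw [Finset.mul_sum]
        refine Finset.sum_le_sum fun y hy => ?_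
        rw [mul_comm, Finset.sum_sub_distrib, ← sq_abs (_ - _)]
        have := (Finset.mem_filter.1 hy).2
        exact mul_le_mul_of_nonneg_left (pow_le_pow_left₀ ht this 2) (hQ y)
    _ ≤ ∑ y : ι → Bool, (∏ i, w i (y i)) * (∑ j, (f j (y j) - e j)) ^ 2 :=
        Finset.sum_le_sum_of_subset_of_nonneg (Finset.filter_subset _ _) fun y _ _ =>
          mul_nonneg (hQ y) (sq_nonneg _)
    _ = ∑ j, ∑ b, w j b * (f j b - e j) ^ 2 := hvar
    _ ≤ ∑ j, ∑ b, w j b * f j b ^ 2 := by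
        refine Finset.sum_le_sum fun j _ => ?_
        have h1 := hw j
        have h2 : e j = ∑ b, w j b * f j b := rfl
        simp only [Fintype.sum_bool] at h1 h2 ⊢
        have : w j true * (f j true - e j) ^ 2 + w j false * (f j false - e j) ^ 2
            = w j true * f j true ^ 2 + w j false * f j false ^ 2 - e j ^ 2 := by
          linear_combination (e j ^ 2) * h1 + 2 * e j * h2
        nlinarith [sq_nonneg (e j)]

/-- The mass function of a Bernoulli variable. -/
def coin (p : ℝ) (b : Bool) : ℝ := if b then p else 1 - p

theorem sum_coin (p : ℝ) : ∑ b, coin p b = 1 := by simp [coin]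

theorem coin_nonneg {p : ℝ} (h0 : 0 ≤ p) (h1 : p ≤ 1) (b : Bool) : 0 ≤ coin p b := by
  cases b <;> simp [coin, h0, h1]

theorem sum_coin_mul_log (p : ℝ) :
    ∑ b, coin p b * Real.log (coin p b) = -Real.binEntropy p := by
  simp [coin, Real.binEntropy]
  ring

/-- This is `|s log s| ≤ 1` squared at `s = √t`. It bounds the second moment of a coin's
log-likelihood by `8`, uniformly in the bias. -/
theorem mul_log_sq_le {t : ℝ} (h0 : 0 ≤ t) (h1 : t ≤ 1) : t * Real.log t ^ 2 ≤ 4 := by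
  rcases h0.eq_or_lt with rfl | h0
  · simp
  have h := (Real.abs_log_mul_self_lt (Real.sqrt t) (Real.sqrt_pos.2 h0) (by simpa using h1)).le
  have h2 := (sq_le_one_iff_abs_le_one _).2 h
  rw [mul_pow, Real.sq_sqrt h0.le, Real.log_sqrt h0.le] at h2
  linarith

/-- The number of points `y` of the cube with `∑ a_i y_i ≤ x` is at least half of the exponential of
the entropy of a product measure whose mean is sufficiently below `x`, up to fluctuations. -/
theorem exp_le_card_of_variance {p a : ι → ℝ} (h0 : ∀ i, 0 ≤ p i) (h1 : ∀ i, p i ≤ 1) {x τ : ℝ}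
    (hτ : 0 < τ) (hmean : ∑ i, p i * a i + τ ≤ x) (hvar : 4 * ∑ i, p i * a i ^ 2 ≤ τ ^ 2) :
    Real.exp (∑ i, Real.binEntropy (p i) - Real.sqrt (32 * Fintype.card ι + 1)) / 2
      ≤ (Finset.univ.filter fun y : ι → Bool => ∑ i, (if y i then a i else 0) ≤ x).card := by
  set w : ι → Bool → ℝ := fun i => coin (p i)
  set Q : (ι → Bool) → ℝ := fun y => ∏ i, w i (y i) with hQdef
  have hw0 : ∀ i b, 0 ≤ w i b := fun i b => coin_nonneg (h0 i) (h1 i) b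
  have hw : ∀ i, ∑ b, w i b = 1 := fun i => sum_coin _
  have hQ : ∀ y, 0 ≤ Q y := fun y => Finset.prod_nonneg fun i _ => hw0 i _
  -- The log-likelihood has second moments summing to at most `8|ι|`, so `t² ≥ 4 · 8|ι|` gives
  -- failure probability at most `1/4`; the `+ 1` keeps `t` positive when `ι` is empty.
  set t := Real.sqrt (32 * Fintype.card ι + 1)
  have htsq : t ^ 2 = 32 * Fintype.card ι + 1 := Real.sq_sqrt (by positivity)
  have ht : 0 < t := Real.sqrt_pos.2 (by positivity)
  have hA := sq_mul_sum_prod_le hw0 hw (fun i b => if b then a i else 0) hτ.le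
  have hB := sq_mul_sum_prod_le hw0 hw (fun i b => Real.log (w i b)) ht.le
  set S := Finset.univ.filter fun y : ι → Bool => ∑ i, (if y i then a i else 0) ≤ x
  set A := Finset.univ.filter fun y : ι → Bool =>
    τ ≤ |∑ j, (if y j then a j else 0) - ∑ j, ∑ b, w j b * (if b then a j else 0)|
  set B := Finset.univ.filter fun y : ι → Bool =>
    t ≤ |∑ j, Real.log (w j (y j)) - ∑ j, ∑ b, w j b * Real.log (w j b)| with hBdef
  have hA' : ∑ y ∈ A, Q y ≤ 1 / 4 := by
    have : ∑ j, ∑ b, w j b * (if b then a j else 0) ^ 2 = ∑ i, p i * a i ^ 2 := by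
      simp [w, coin]
    have h2 : 0 < τ ^ 2 := by positivity
    nlinarith
  have hB' : ∑ y ∈ B, Q y ≤ 1 / 4 := by
    have : ∑ j, ∑ b, w j b * Real.log (w j b) ^ 2 ≤ 8 * Fintype.card ι := by
      calc ∑ j, ∑ b, w j b * Real.log (w j b) ^ 2 ≤ ∑ j : ι, (8 : ℝ) := by
            refine Finset.sum_le_sum fun j _ => ?_
            have hle : ∀ b, w j b ≤ 1 := fun b => by
              cases b <;> simp [w, coin, h0 j, h1 j]
            have ht' := mul_log_sq_le (hw0 j true) (hle true)
            have hf' := mul_log_sq_le (hw0 j false) (hle false)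
            simp only [Fintype.sum_bool]
            linarith
        _ = 8 * Fintype.card ι := by simp [mul_comm]
    have h2 : 0 < t ^ 2 := by positivity
    have h3 := hB.trans this
    nlinarith
  have htot : ∑ y, Q y = 1 := by
    rw [hQdef, sum_prod_apply]
    exact Finset.prod_eq_one fun i _ => hw i
  have hent : ∑ j, ∑ b, w j b * Real.log (w j b) = -∑ i, Real.binEntropy (p i) := by
    rw [← Finset.sum_neg_distrib]
    exact Finset.sum_congr rfl fun j _ => sum_coin_mul_log _
  have hmn : ∑ j, ∑ b, w j b * (if b then a j else 0) = ∑ i, p i * a i := by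
    simp [w, coin]
  set H := ∑ i, Real.binEntropy (p i)
  -- A point outside `A` exceeds the mean by less than `τ`, hence lies in `S`; so the three sets
  -- cover the cube.
  have hcover : (1 : ℝ) ≤ ∑ y ∈ A, Q y + ∑ y ∈ B, Q y + ∑ y ∈ S \ B, Q y := by
    rw [← htot]
    have hsub : (Finset.univ : Finset (ι → Bool)) ⊆ (A ∪ B) ∪ (S \ B) := by
      intro y _
      by_cases hy : y ∈ B
      · simp [hy]
      by_cases hyA : y ∈ A
      · simp [hyA]
      have hyS : y ∈ S := by
        simp only [A, Finset.mem_filter, Finset.mem_univ, true_and, not_le, hmn] at hyA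
        simp only [S, Finset.mem_filter, Finset.mem_univ, true_and]
        linarith [(abs_lt.1 hyA).2]
      simp [hy, hyS]
    have hun : ∀ s s' : Finset (ι → Bool), ∑ y ∈ s ∪ s', Q y ≤ ∑ y ∈ s, Q y + ∑ y ∈ s', Q y := by
      intro s s'
      have := Finset.sum_union_inter (s₁ := s) (s₂ := s') (f := Q)
      have := Finset.sum_nonneg (s := s ∩ s') fun y _ => hQ y
      linarith
    have e1 := Finset.sum_le_sum_of_subset_of_nonneg hsub fun y _ _ => hQ y
    have e2 := hun (A ∪ B) (S \ B)
    have e3 := hun A B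
    linarith
  have hbd : ∀ y ∈ S \ B, Q y ≤ Real.exp (t - H) := by
    intro y hy
    have hyB := (Finset.mem_sdiff.1 hy).2
    simp only [hBdef, Finset.mem_filter, Finset.mem_univ, true_and, not_le, hent] at hyB
    calc Q y ≤ ∏ i, Real.exp (Real.log (w i (y i))) :=
          Finset.prod_le_prod (fun i _ => hw0 i _) fun i _ => Real.le_exp_log _
      _ = Real.exp (∑ i, Real.log (w i (y i))) := (Real.exp_sum _ _).symm
      _ ≤ Real.exp (t - H) := Real.exp_le_exp.2 (by linarith [(abs_lt.1 hyB).2])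
  have hsum : ∑ y ∈ S \ B, Q y ≤ S.card * Real.exp (t - H) := by
    calc ∑ y ∈ S \ B, Q y ≤ (S \ B).card • Real.exp (t - H) := Finset.sum_le_card_nsmul _ _ _ hbd
      _ ≤ S.card * Real.exp (t - H) := by
        rw [nsmul_eq_mul]
        gcongr
        exact Finset.sdiff_subset
  have hexp : Real.exp (t - H) * Real.exp (H - t) = 1 := by
    rw [← Real.exp_add]; simp
  have hhalf : 1 / 2 ≤ S.card * Real.exp (t - H) := by linarith
  have := mul_le_mul_of_nonneg_right hhalf (Real.exp_pos (H - t)).le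
  rw [mul_assoc, hexp] at this
  linarith

/-- Subadditivity of entropy: a finite set of points of the cube has at most `exp` of the sum of the
entropies of its coordinate marginals many elements. -/
theorem card_le_exp_sum_binEntropy {F : Finset (ι → Bool)} (hF : F.Nonempty) :
    (F.card : ℝ) ≤ Real.exp (∑ i, Real.binEntropy ((F.filter fun y => y i).card / F.card)) := by
  set N : ℝ := (F.card : ℝ) with hN
  have hNpos : 0 < N := by rw [hN]; exact_mod_cast hF.card_pos
  set q : ι → ℝ := fun i => (F.filter fun y => y i).card / N with hq
  have hcompl : ∀ i, 1 - q i = (F.filter fun y => ¬ y i).card / N := by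
    intro i
    have := Finset.card_filter_add_card_filter_not (s := F) (fun y : ι → Bool => (y i : Prop))
    have h2 : ((F.filter fun y => y i).card : ℝ) + (F.filter fun y => ¬ y i).card = N := by
      rw [hN]; exact_mod_cast this
    rw [hq]
    field_simp
    linarith
  -- Each `y ∈ F` is itself counted in its own marginals, so no logarithm below is taken at `0`.
  have hpos : ∀ y ∈ F, ∀ i, 0 < coin (q i) (y i) := by
    intro y hy i
    cases hyi : y i
    · simp only [coin, Bool.false_eq_true, if_false, hcompl]
      refine div_pos ?_ hNpos
      exact_mod_cast Finset.card_pos.2 ⟨y, by simp [hy, hyi]⟩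
    · simp only [coin, if_true, hq]
      refine div_pos ?_ hNpos
      exact_mod_cast Finset.card_pos.2 ⟨y, by simp [hy, hyi]⟩
  have hq0 : ∀ i, 0 ≤ q i := fun i => by positivity
  have hq1 : ∀ i, q i ≤ 1 := fun i => by
    have : 0 ≤ 1 - q i := by rw [hcompl]; positivity
    linarith
  have hmarg : ∀ i, ∑ y ∈ F, Real.log (coin (q i) (y i)) = -N * Real.binEntropy (q i) := by
    intro i
    have hl : ∀ y : ι → Bool, Real.log (coin (q i) (y i))
        = if y i then Real.log (q i) else Real.log (1 - q i) := fun y => by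
      cases y i <;> simp [coin]
    simp only [hl]
    rw [Finset.sum_ite, Finset.sum_const, Finset.sum_const, nsmul_eq_mul, nsmul_eq_mul]
    have e1 : ((F.filter fun y => y i).card : ℝ) = N * q i :=
      (mul_div_cancel₀ _ hNpos.ne').symm
    have e2 : ((F.filter fun y => ¬ y i).card : ℝ) = N * (1 - q i) := by
      rw [hcompl, mul_div_cancel₀ _ hNpos.ne']
    rw [e1, e2, Real.binEntropy]
    simp only [Real.log_inv]
    ring
  -- Nonnegativity of the relative entropy of the uniform law on `F` against the product of its
  -- marginals, via `log z ≤ z - 1`.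
  have hlog : ∑ y ∈ F, Real.log (N * ∏ i, coin (q i) (y i)) ≤ 0 := by
    calc ∑ y ∈ F, Real.log (N * ∏ i, coin (q i) (y i))
        ≤ ∑ y ∈ F, (N * ∏ i, coin (q i) (y i) - 1) := by
          refine Finset.sum_le_sum fun y hy => Real.log_le_sub_one_of_pos ?_
          exact mul_pos hNpos (Finset.prod_pos fun i _ => hpos y hy i)
      _ = N * ∑ y ∈ F, ∏ i, coin (q i) (y i) - N := by
          rw [Finset.sum_sub_distrib, ← Finset.mul_sum, Finset.sum_const, nsmul_eq_mul, ← hN,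
            mul_one]
      _ ≤ N * 1 - N := by
          gcongr
          calc ∑ y ∈ F, ∏ i, coin (q i) (y i) ≤ ∑ y : ι → Bool, ∏ i, coin (q i) (y i) :=
                Finset.sum_le_sum_of_subset_of_nonneg (Finset.subset_univ _) fun y _ _ =>
                  Finset.prod_nonneg fun i _ => coin_nonneg (hq0 i) (hq1 i) _
            _ = 1 := by
                rw [sum_prod_apply]
                exact Finset.prod_eq_one fun i _ => sum_coin _
      _ = 0 := by ring
  have hsplit : ∑ y ∈ F, Real.log (N * ∏ i, coin (q i) (y i))
      = N * Real.log N - N * ∑ i, Real.binEntropy (q i) := by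
    have : ∀ y ∈ F, Real.log (N * ∏ i, coin (q i) (y i))
        = Real.log N + ∑ i, Real.log (coin (q i) (y i)) := fun y hy => by
      rw [Real.log_mul hNpos.ne' (Finset.prod_pos fun i _ => hpos y hy i).ne',
        Real.log_prod fun i _ => (hpos y hy i).ne']
    rw [Finset.sum_congr rfl this, Finset.sum_add_distrib, Finset.sum_comm,
      Finset.sum_congr rfl fun i _ => hmarg i, ← Finset.mul_sum,
      Finset.sum_const, nsmul_eq_mul, ← hN]
    ring
  rw [hsplit] at hlog
  have : Real.log N ≤ ∑ i, Real.binEntropy (q i) := by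
    nlinarith
  exact (Real.log_le_iff_le_exp hNpos).1 this

end ProductWeights

/-! ### Entropy of the product law -/

theorem P_real_singleton (n : ℕ) (x : ℝ) (y : Idx n → Bool) :
    (P n x).real {y} = ∏ m, coin (optProb n x m) (y m) := by
  rw [P, MeasureTheory.measureReal_def, MeasureTheory.Measure.pi_singleton, ENNReal.toReal_prod]
  refine Finset.prod_congr rfl fun m _ => ?_
  rw [← MeasureTheory.measureReal_def, ProbabilityTheory.bernoulliMeasure_real_apply _ (by simp)]
  cases y m <;> simp [coin]

theorem shannonEntropy_P (n : ℕ) (x : ℝ) :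
    shannonEntropy (P n x) = ∑ m, h (optProb n x m) := by
  have hlog : ∀ y : Idx n → Bool, (P n x).real {y} * Real.logb 2 ((P n x).real {y})
      = (∏ m, coin (optProb n x m) (y m)) * ∑ m, Real.logb 2 (coin (optProb n x m) (y m)) := by
    intro y
    rw [P_real_singleton]
    -- Some parameters may be `0` or `1`; points of zero mass contribute nothing, and elsewhere the
    -- logarithm splits.
    by_cases hz : ∏ m, coin (optProb n x m) (y m) = 0
    · rw [hz, zero_mul, zero_mul]
    · rw [Real.logb_prod _ _ (Finset.prod_ne_zero_iff.1 hz)]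
  rw [shannonEntropy, Finset.sum_congr rfl fun y _ => hlog y,
    sum_prod_mul_sum (fun m => sum_coin _) fun m b => Real.logb 2 (coin (optProb n x m) b),
    ← Finset.sum_neg_distrib]
  refine Finset.sum_congr rfl fun m _ => ?_
  simp [coin, h]
  ring

end EgyptianEntropy

/-! ### The Boltzmann profile and Gibbs' inequality -/

namespace EgyptianEntropy

/-- The function `1 / (1 + e^t)`. -/
def fermi (t : ℝ) : ℝ := (1 + Real.exp t)⁻¹

theorem fermi_pos (t : ℝ) : 0 < fermi t := by unfold fermi; positivity

theorem fermi_lt_one (t : ℝ) : fermi t < 1 :=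
  inv_lt_one_of_one_lt₀ (by linarith [Real.exp_pos t])

theorem fermi_le_half {t : ℝ} (ht : 0 ≤ t) : fermi t ≤ 1 / 2 := by
  rw [fermi, one_div]
  exact inv_anti₀ two_pos (by linarith [Real.one_le_exp ht])

theorem exp_neg_le_two_mul_fermi {t : ℝ} (ht : 0 ≤ t) : Real.exp (-t) ≤ 2 * fermi t := by
  have h1 := Real.one_le_exp ht
  rw [fermi, Real.exp_neg, ← div_eq_mul_inv, inv_eq_one_div,
    div_le_div_iff₀ (Real.exp_pos t) (by positivity)]
  linarith

theorem half_sub_le_fermi {t : ℝ} (ht : 0 ≤ t) : (1 - t) / 2 ≤ fermi t := by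
  rcases le_or_gt 1 t with h1 | h1
  · exact le_trans (by linarith) (fermi_pos t).le
  · have h2 : Real.exp t * (1 - t) ≤ 1 := by
      have := Real.one_sub_le_exp_neg t
      have h3 := mul_le_mul_of_nonneg_left this (Real.exp_pos t).le
      rwa [← Real.exp_add, add_neg_cancel, Real.exp_zero] at h3
    rw [fermi, inv_eq_one_div, div_le_div_iff₀ two_pos (by positivity)]
    linarith

theorem sq_mul_fermi_le_two {t : ℝ} (ht : 0 ≤ t) : t ^ 2 * fermi t ≤ 2 := by
  have h := Real.quadratic_le_exp_of_nonneg ht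
  rw [fermi, ← div_eq_mul_inv, div_le_iff₀ (by positivity)]
  linarith

theorem mul_fermi_le_one {t : ℝ} : t * fermi t ≤ 1 := by
  rw [fermi, ← div_eq_mul_inv, div_le_iff₀ (by positivity)]
  linarith [Real.add_one_le_exp t]

theorem continuous_fermi : Continuous fermi :=
  (continuous_const.add Real.continuous_exp).inv₀ fun t =>
    (show (0 : ℝ) < 1 + Real.exp t by positivity).ne'

theorem one_sub_fermi (t : ℝ) : 1 - fermi t = (1 + Real.exp (-t))⁻¹ := by
  rw [fermi, Real.exp_neg]
  field_simp
  ring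

theorem log_one_sub_fermi (t : ℝ) : Real.log (1 - fermi t) = -Real.log (1 + Real.exp (-t)) := by
  rw [one_sub_fermi, Real.log_inv]

theorem log_fermi (t : ℝ) : Real.log (fermi t) = -t - Real.log (1 + Real.exp (-t)) := by
  have h : 1 + Real.exp t = Real.exp t * (1 + Real.exp (-t)) := by
    rw [mul_add, ← Real.exp_add, add_neg_cancel, Real.exp_zero]; ring
  rw [fermi, Real.log_inv, h, Real.log_mul (Real.exp_pos t).ne' (by positivity), Real.log_exp]
  ring

theorem binEntropy_fermi (t : ℝ) :
    Real.binEntropy (fermi t) = Real.log (1 + Real.exp (-t)) + t * fermi t := by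
  simp only [Real.binEntropy, Real.log_inv, log_one_sub_fermi, log_fermi]
  ring

theorem mul_log_sub_mul_log_le {p q : ℝ} (hp : 0 < p) (hq : 0 ≤ q) :
    q * Real.log p - q * Real.log q ≤ p - q := by
  rcases hq.eq_or_lt with rfl | hq
  · simpa using hp.le
  · have h := Real.log_le_sub_one_of_pos (div_pos hp hq)
    rw [Real.log_div hp.ne' hq.ne'] at h
    calc q * Real.log p - q * Real.log q = q * (Real.log p - Real.log q) := by ring
      _ ≤ q * (p / q - 1) := by gcongr
      _ = p - q := by field_simp

/-- Gibbs' inequality against the Boltzmann weight `fermi t`. -/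
theorem binEntropy_le_of_tilt (t : ℝ) {q : ℝ} (h0 : 0 ≤ q) (h1 : q ≤ 1) :
    Real.binEntropy q ≤ Real.log (1 + Real.exp (-t)) + t * q := by
  have e1 := mul_log_sub_mul_log_le (fermi_pos t) h0
  have e2 := mul_log_sub_mul_log_le (sub_pos.2 (fermi_lt_one t)) (sub_nonneg.2 h1)
  rw [log_fermi] at e1
  rw [log_one_sub_fermi] at e2
  simp only [Real.binEntropy, Real.log_inv]
  linarith

/-! ### Choice of the multiplier, and harmonic-type sums -/

theorem exists_sum_fermi_eq {n : ℕ} {x : ℝ} (hx : 0 < x) (hxn : x < Real.log n / 2) :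
    ∃ l : ℝ, 0 < l ∧ ∑ m ∈ Finset.Icc 1 n, fermi (l / m) / m = x := by
  set g : ℝ → ℝ := fun l => ∑ m ∈ Finset.Icc 1 n, fermi (l / m) / m with hg
  have hcont : Continuous g := continuous_finsetSum _ fun m _ =>
    (continuous_fermi.comp (continuous_id.div_const _)).div_const _
  have hn : 0 < (n : ℝ) := by
    rcases Nat.eq_zero_or_pos n with rfl | h
    · simp at hxn; linarith
    · exact_mod_cast h
  -- All parameters equal `1/2` at `l = 0`, so the mean is half the harmonic number; this is where
  -- `x < log n / 2` matters.
  have hg0 : x < g 0 := by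
    have h1 := log_add_one_le_harmonic n
    rw [harmonic_eq_sum_Icc] at h1
    have h2 : Real.log n ≤ Real.log ↑(n + 1) := Real.log_le_log hn (by push_cast; linarith)
    have h3 : g 0 = (∑ m ∈ Finset.Icc 1 n, (m : ℝ)⁻¹) / 2 := by
      rw [hg, Finset.sum_div]
      refine Finset.sum_congr rfl fun m _ => ?_
      simp [fermi]
      ring
    push_cast at h1 h2
    rw [h3]
    linarith
  have hlarge : g (n / x) ≤ x := by
    calc g (n / x) ≤ ∑ m ∈ Finset.Icc 1 n, x / n := by
          refine Finset.sum_le_sum fun m hm => ?_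
          have hm0 : (0 : ℝ) < m := by exact_mod_cast (Finset.mem_Icc.1 hm).1
          have h := mul_fermi_le_one (t := n / x / m)
          rw [le_div_iff₀ hn]
          calc fermi (n / x / m) / m * n = x * (n / x / m * fermi (n / x / m)) := by field_simp
            _ ≤ x * 1 := by gcongr
            _ = x := mul_one x
      _ = x := by simp; field_simp
  obtain ⟨l, hl, hgl⟩ := intermediate_value_Icc' (a := 0) (b := n / x) (by positivity)
    hcont.continuousOn ⟨hlarge, hg0.le⟩
  refine ⟨l, hl.1.lt_of_ne ?_, hgl⟩
  rintro rfl
  exact hg0.ne' hgl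

theorem log_div_le_sum_Ico {k n : ℕ} (hk : 1 ≤ k) (hkn : k ≤ n) :
    Real.log (n / k) ≤ ∑ m ∈ Finset.Ico k n, (m : ℝ)⁻¹ := by
  have hk0 : (0 : ℝ) < k := by exact_mod_cast hk
  induction n, hkn using Nat.le_induction with
  | base => simp [hk0.ne']
  | succ n hkn ih =>
    have hn : (0 : ℝ) < n := by exact_mod_cast hk.trans hkn
    rw [Finset.sum_Ico_succ_top hkn]
    have h1 : (((n + 1 : ℕ) : ℝ) / k) = (n / k) * ((n + 1) / n) := by
      push_cast; field_simp
    have h2 := Real.log_le_sub_one_of_pos (show (0 : ℝ) < (n + 1) / n by positivity)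
    have h3 : ((n : ℝ) + 1) / n - 1 = (n : ℝ)⁻¹ := by field_simp; ring
    rw [h1, Real.log_mul (by positivity) (by positivity)]
    linarith

theorem sum_Icc_inv_sq_le {k : ℕ} (hk : 1 ≤ k) (n : ℕ) :
    ∑ m ∈ Finset.Icc k n, ((m : ℝ) ^ 2)⁻¹ ≤ 2 / k := by
  have h := sum_Ioo_inv_sq_le (α := ℝ) (k - 1) (n + 1)
  have e : Finset.Ioo (k - 1) (n + 1) = Finset.Icc k n := by
    ext m; simp only [Finset.mem_Ioo, Finset.mem_Icc]; omega
  rw [e, Nat.cast_sub hk] at h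
  simpa using h

/-! ### Entropy and variance of the profile -/

section Profile

variable {n : ℕ} {l x : ℝ}

/-- Termwise, the entropy at `t = l/m` is at most `(2 + t) fermi t`, and `m ≤ n` turns this into
`(2n + l)` times the contribution of `m` to the mean. -/
theorem sum_binEntropy_fermi_le (hl : 0 < l)
    (hx : ∑ m ∈ Finset.Icc 1 n, fermi (l / m) / m = x) :
    ∑ m ∈ Finset.Icc 1 n, Real.binEntropy (fermi (l / m)) ≤ (2 * n + l) * x := by
  rw [← hx, Finset.mul_sum]
  refine Finset.sum_le_sum fun m hm => ?_
  obtain ⟨hm1, hmn⟩ := Finset.mem_Icc.1 hm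
  have hm0 : (0 : ℝ) < m := by exact_mod_cast hm1
  have hmn' : (m : ℝ) ≤ n := by exact_mod_cast hmn
  have ht : 0 ≤ l / m := by positivity
  have h1 : Real.log (1 + Real.exp (-(l / m))) ≤ 2 * fermi (l / m) := by
    have := Real.log_le_sub_one_of_pos (show 0 < 1 + Real.exp (-(l / m)) by positivity)
    linarith [exp_neg_le_two_mul_fermi ht]
  have hF := fermi_pos (l / m)
  have h2 : fermi (l / m) ≤ n * (fermi (l / m) / m) := by
    rw [mul_div_assoc', le_div_iff₀ hm0, mul_comm]
    gcongr
  rw [binEntropy_fermi]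
  have h3 : l / m * fermi (l / m) = l * (fermi (l / m) / m) := by ring
  rw [h3]
  linarith

theorem sq_mul_sum_fermi_div_sq_le (hl : 0 < l) (s : Finset ℕ) :
    l ^ 2 * ∑ m ∈ s, fermi (l / m) / (m : ℝ) ^ 2 ≤ 2 * s.card := by
  rw [Finset.mul_sum]
  calc ∑ m ∈ s, l ^ 2 * (fermi (l / m) / (m : ℝ) ^ 2) ≤ ∑ m ∈ s, (2 : ℝ) := by
        refine Finset.sum_le_sum fun m hm => ?_
        have h := sq_mul_fermi_le_two (t := l / m) (by positivity)
        calc l ^ 2 * (fermi (l / m) / (m : ℝ) ^ 2) = (l / m) ^ 2 * fermi (l / m) := by ring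
          _ ≤ 2 := h
    _ = 2 * s.card := by simp [mul_comm]

/-- Here `k = ⌈l⌉`. Below `k`, each term is at most `2/l²` and there are `k - 1 < l` of them; from
`k` on, `fermi ≤ 1/2` and the tail of `∑ 1/m²` is at most `2/k`. -/
theorem sum_fermi_div_sq_le {k : ℕ} (hl : 0 < l) (hk1 : (k : ℝ) < l + 1) (hk2 : l ≤ k)
    (hkn : k ≤ n) :
    ∑ m ∈ Finset.Icc 1 n, fermi (l / m) / (m : ℝ) ^ 2 ≤ 5 / k := by
  have hk0 : (0 : ℝ) < k := hl.trans_le hk2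
  have hk : 1 ≤ k := by exact_mod_cast hk0
  have hsplit : Finset.Icc 1 n = Finset.Ico 1 k ∪ Finset.Icc k n := by
    ext m; simp only [Finset.mem_union, Finset.mem_Ico, Finset.mem_Icc]; omega
  have hdisj : Disjoint (Finset.Ico 1 k) (Finset.Icc k n) := by
    rw [Finset.disjoint_left]; intro m
    simp only [Finset.mem_Ico, Finset.mem_Icc]; omega
  have hlow : ∑ m ∈ Finset.Ico 1 k, fermi (l / m) / (m : ℝ) ^ 2 ≤ 4 / k := by
    rcases hk.eq_or_lt with rfl | hk
    · simp
    · have h := sq_mul_sum_fermi_div_sq_le hl (Finset.Ico 1 k)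
      have hk2' : (2 : ℝ) ≤ k := by exact_mod_cast hk
      rw [Nat.card_Ico, Nat.cast_sub hk.le, Nat.cast_one] at h
      rw [le_div_iff₀ hk0]
      set S := ∑ m ∈ Finset.Ico 1 k, fermi (l / m) / (m : ℝ) ^ 2
      have hS : 0 ≤ S := Finset.sum_nonneg fun m _ => by have := fermi_pos (l / m); positivity
      have h2 : ((k : ℝ) - 1) ^ 2 * S ≤ 2 * (k - 1) := by
        refine le_trans ?_ h
        gcongr <;> linarith
      have h3 : ((k : ℝ) - 1) * S ≤ 2 := by
        refine le_of_mul_le_mul_left ?_ (show (0 : ℝ) < k - 1 by linarith)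
        linarith
      nlinarith
  have hhigh : ∑ m ∈ Finset.Icc k n, fermi (l / m) / (m : ℝ) ^ 2 ≤ 1 / k := by
    calc ∑ m ∈ Finset.Icc k n, fermi (l / m) / (m : ℝ) ^ 2
        ≤ ∑ m ∈ Finset.Icc k n, 1 / 2 * ((m : ℝ) ^ 2)⁻¹ := by
          refine Finset.sum_le_sum fun m _ => ?_
          rw [div_eq_mul_inv]
          gcongr
          exact fermi_le_half (by positivity)
      _ ≤ 1 / 2 * (2 / k) := by
          rw [← Finset.mul_sum]
          gcongr
          exact sum_Icc_inv_sq_le hk n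
      _ = 1 / k := by ring
  rw [hsplit, Finset.sum_union hdisj]
  calc _ ≤ (4 : ℝ) / k + 1 / k := add_le_add hlow hhigh
    _ = 5 / k := by ring

/-- By `fermi t ≥ (1 - t)/2`, the indices `m ≥ k` contribute at least `log (n/k)/2 - 1` to `x`. The
constant `8` absorbs `e²`. -/
theorem div_le_mul_exp {k : ℕ} (hl : 0 < l) (hk2 : l ≤ k) (hkn : k ≤ n)
    (hx : ∑ m ∈ Finset.Icc 1 n, fermi (l / m) / m = x) :
    (n : ℝ) / k ≤ 8 * Real.exp (2 * x) := by
  have hk0 : (0 : ℝ) < k := hl.trans_le hk2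
  have hk : 1 ≤ k := by exact_mod_cast hk0
  have hn0 : (0 : ℝ) < n := by exact_mod_cast hk.trans hkn
  have h1 : Real.log (n / k) ≤ ∑ m ∈ Finset.Icc k n, (m : ℝ)⁻¹ :=
    (log_div_le_sum_Ico hk hkn).trans
      (Finset.sum_le_sum_of_subset_of_nonneg Finset.Ico_subset_Icc_self fun m _ _ => by positivity)
  have h2 := sum_Icc_inv_sq_le hk n
  have h3 : 1 / 2 * ∑ m ∈ Finset.Icc k n, (m : ℝ)⁻¹
      - l / 2 * ∑ m ∈ Finset.Icc k n, ((m : ℝ) ^ 2)⁻¹ ≤ x := by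
    rw [← hx, Finset.mul_sum, Finset.mul_sum, ← Finset.sum_sub_distrib]
    calc _ ≤ ∑ m ∈ Finset.Icc k n, fermi (l / m) / m := by
          refine Finset.sum_le_sum fun m hm => ?_
          have hm0 : (0 : ℝ) < m := by exact_mod_cast hk.trans (Finset.mem_Icc.1 hm).1
          calc 1 / 2 * (m : ℝ)⁻¹ - l / 2 * ((m : ℝ) ^ 2)⁻¹ = (1 - l / m) / 2 / m := by
                field_simp
            _ ≤ fermi (l / m) / m := by
                gcongr
                exact half_sub_le_fermi (by positivity)
      _ ≤ _ := Finset.sum_le_sum_of_subset_of_nonneg (Finset.Icc_subset_Icc_left hk) fun m _ _ => by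
          have := fermi_pos (l / m); positivity
  have h4 : l / 2 * ∑ m ∈ Finset.Icc k n, ((m : ℝ) ^ 2)⁻¹ ≤ 1 := by
    calc _ ≤ (k : ℝ) / 2 * (2 / k) := by gcongr
      _ = 1 := by field_simp
  have h5 : Real.log (n / k) ≤ 2 + 2 * x := by linarith
  rw [Real.log_le_iff_le_exp (by positivity), Real.exp_add] at h5
  refine h5.trans ?_
  gcongr
  have h6 : Real.exp 2 = Real.exp 1 ^ 2 := by rw [← Real.exp_nat_mul]; norm_num
  rw [h6]
  have h7 := Real.exp_one_lt_d9
  have h8 := Real.exp_pos 1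
  nlinarith

theorem sq_mul_sum_fermi_le (hl : 0 < l) (hx : ∑ m ∈ Finset.Icc 1 n, fermi (l / m) / m = x)
    (hx0 : 0 ≤ x) :
    (2 * n + l) ^ 2 * ∑ m ∈ Finset.Icc 1 n, fermi (l / m) / (m : ℝ) ^ 2
      ≤ 18 ^ 2 * (n * Real.exp (2 * x)) := by
  set V := ∑ m ∈ Finset.Icc 1 n, fermi (l / m) / (m : ℝ) ^ 2
  have hV : 0 ≤ V := Finset.sum_nonneg fun m _ => by have := fermi_pos (l / m); positivity
  have he : 1 ≤ Real.exp (2 * x) := Real.one_le_exp (by linarith)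
  have hne : (n : ℝ) ≤ n * Real.exp (2 * x) := le_mul_of_one_le_right n.cast_nonneg he
  have h1 : l ^ 2 * V ≤ 2 * n := by
    have := sq_mul_sum_fermi_div_sq_le hl (Finset.Icc 1 n)
    simpa using this
  have h2 : (n : ℝ) ^ 2 * V ≤ 40 * (n * Real.exp (2 * x)) := by
    rcases le_or_gt ⌈l⌉₊ n with hkn | hkn
    · have hV' := sum_fermi_div_sq_le hl (Nat.ceil_lt_add_one hl.le) (Nat.le_ceil l) hkn
      have hd := div_le_mul_exp hl (Nat.le_ceil l) hkn hx
      calc (n : ℝ) ^ 2 * V ≤ n ^ 2 * (5 / ⌈l⌉₊) := by gcongr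
        _ = 5 * (n : ℝ) * ((n : ℝ) / (⌈l⌉₊ : ℝ)) := by ring
        _ ≤ 5 * (n : ℝ) * (8 * Real.exp (2 * x)) := by gcongr
        _ = _ := by ring
    -- No index exceeds `l` in this case, and the bound on `l² V` suffices.
    · have hnl : (n : ℝ) ≤ l := (Nat.lt_ceil.1 hkn).le
      have : (n : ℝ) ^ 2 * V ≤ l ^ 2 * V := by gcongr
      linarith
  -- `(2n + l)² ≤ 8n² + 2l²`, and `8·40 + 2·2 = 18²`.
  nlinarith [sq_nonneg (2 * (n : ℝ) - l)]

end Profile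

end EgyptianEntropy

/-! ### Subsets as points of the cube, and the upper bound -/

namespace EgyptianEntropy

theorem countSubsets_Icc (n : ℕ) (x : ℝ) :
    countSubsets (Finset.Icc 1 n) x
      = (Finset.univ.filter fun y : Idx n → Bool =>
          ∑ m, (if y m then 1 / ((m : ℕ) : ℝ) else 0) ≤ x).card := by
  have hsum : ∀ A ⊆ Finset.Icc 1 n,
      recipSum A = ∑ m : Idx n, if (m : ℕ) ∈ A then 1 / ((m : ℕ) : ℝ) else 0 := by
    intro A hA
    rw [Finset.sum_coe_sort (Finset.Icc 1 n) fun m : ℕ => if m ∈ A then 1 / (m : ℝ) else 0,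
      ← Finset.sum_filter, Finset.filter_mem_eq_inter, Finset.inter_eq_right.2 hA, recipSum]
  have hmem : ∀ (y : Idx n → Bool) (m : Idx n),
      (m : ℕ) ∈ (Finset.univ.filter fun i => y i = true).map (Function.Embedding.subtype _)
        ↔ y m = true := by
    intro y m
    simp only [Finset.mem_map, Finset.mem_filter, Finset.mem_univ, true_and]
    constructor
    · rintro ⟨i, hi, him⟩
      rwa [← Subtype.ext (show (i : ℕ) = m from him)]
    · exact fun hm => ⟨m, hm, rfl⟩
  have hsub : ∀ y : Idx n → Bool,
      (Finset.univ.filter fun i => y i = true).map (Function.Embedding.subtype _)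
        ⊆ Finset.Icc 1 n := by
    intro y a ha
    obtain ⟨i, -, rfl⟩ := Finset.mem_map.1 ha
    exact i.2
  refine Finset.card_nbij' (fun A m => decide ((m : ℕ) ∈ A))
    (fun y => (Finset.univ.filter fun i => y i = true).map (Function.Embedding.subtype _))
    ?_ ?_ ?_ ?_
  · intro A hA
    simp only [Finset.coe_filter, Finset.mem_powerset, Set.mem_ofPred_eq] at hA
    simp only [Finset.coe_filter, Finset.mem_univ, true_and, Set.mem_ofPred_eq, decide_eq_true_eq]
    rw [← hsum A hA.1]
    exact hA.2
  · intro y hy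
    simp only [Finset.coe_filter, Finset.mem_univ, true_and, Set.mem_ofPred_eq] at hy
    simp only [Finset.coe_filter, Finset.mem_powerset, Set.mem_ofPred_eq]
    refine ⟨hsub y, ?_⟩
    rw [hsum _ (hsub y)]
    simpa only [hmem] using hy
  · intro A hA
    simp only [Finset.coe_filter, Finset.mem_powerset, Set.mem_ofPred_eq] at hA
    ext a
    constructor
    · intro ha
      obtain ⟨i, hi, rfl⟩ := Finset.mem_map.1 ha
      simpa using hi
    · intro ha
      exact (hmem _ ⟨a, hA.1 ha⟩).2 (by simpa using ha)
  · intro y _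
    funext m
    rw [Bool.eq_iff_iff, decide_eq_true_eq]
    exact hmem y m

theorem recipSum_mono {A B : Finset ℕ} (h : A ⊆ B) : recipSum A ≤ recipSum B :=
  Finset.sum_le_sum_of_subset_of_nonneg h fun _ _ _ => by positivity

/-- The map `A ↦ (A \ U, A ∩ U)` is injective, and passing to `A ∩ U` only lowers the reciprocal
sum. -/
theorem countSubsets_le_two_pow_mul {U V : Finset ℕ} (hUV : U ⊆ V) (x : ℝ) :
    countSubsets V x ≤ 2 ^ (V.card - U.card) * countSubsets U x := by
  rw [← Finset.card_sdiff_of_subset hUV, ← Finset.card_powerset, countSubsets, countSubsets,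
    ← Finset.card_product]
  refine Finset.card_le_card_of_injOn (fun A => (A \ U, A ∩ U)) ?_ ?_
  · intro A hA
    simp only [Finset.coe_filter, Finset.mem_powerset, Set.mem_ofPred_eq] at hA
    simp only [Finset.coe_product, Set.mem_prod, Finset.mem_coe, Finset.mem_powerset,
      Finset.mem_filter]
    exact ⟨Finset.sdiff_subset_sdiff hA.1 le_rfl, Finset.inter_subset_right,
      (recipSum_mono Finset.inter_subset_left).trans hA.2⟩
  · intro A _ B _ hAB
    simp only [Prod.mk.injEq] at hAB
    rw [← Finset.sdiff_union_inter A U, ← Finset.sdiff_union_inter B U, hAB.1, hAB.2]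

theorem one_le_countSubsets (U : Finset ℕ) {x : ℝ} (hx : 0 ≤ x) : 1 ≤ countSubsets U x :=
  Finset.card_pos.2 ⟨∅, by simpa [recipSum] using hx⟩

theorem sum_h_eq (n : ℕ) (q : Idx n → ℝ) :
    ∑ m, h (q m) = (∑ m, Real.binEntropy (q m)) / Real.log 2 := by
  simp only [h_eq_binEntropy, Finset.sum_div]

theorem two_rpow_div_log_two (t : ℝ) : (2 : ℝ) ^ (t / Real.log 2) = Real.exp t := by
  rw [Real.rpow_def_of_pos two_pos, mul_div_cancel₀ _ (Real.log_pos one_lt_two).ne']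

theorem sum_binEntropy_le_optProb {n : ℕ} {x : ℝ} (hx : 0 ≤ x) (q : Idx n → I)
    (hq : q ∈ feasible n x) :
    ∑ m, Real.binEntropy (q m) ≤ ∑ m, Real.binEntropy (optProb n x m) := by
  have hmax : ∑ m, h (q m) ≤ ∑ m, h (optProb n x m) := (optProb_spec n hx).2 hq
  rw [sum_h_eq, sum_h_eq] at hmax
  exact (div_le_div_iff_of_pos_right (Real.log_pos one_lt_two)).1 hmax

theorem countSubsets_le_two_rpow_entropy {x : ℝ} (hx : 0 ≤ x) (n : ℕ) :
    (countSubsets (Finset.Icc 1 n) x : ℝ) ≤ 2 ^ shannonEntropy (P n x) := by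
  rw [shannonEntropy_P, sum_h_eq, two_rpow_div_log_two, countSubsets_Icc]
  set F := Finset.univ.filter fun y : Idx n → Bool =>
    ∑ m, (if y m then 1 / ((m : ℕ) : ℝ) else 0) ≤ x with hFdef
  have hF : F.Nonempty := ⟨fun _ => false, by simpa [F] using hx⟩
  have hpos : (0 : ℝ) < F.card := by exact_mod_cast hF.card_pos
  refine (card_le_exp_sum_binEntropy hF).trans (Real.exp_le_exp.2 ?_)
  refine sum_binEntropy_le_optProb hx
    (fun m => ⟨(F.filter fun y => y m).card / F.card, by positivity, ?_⟩) ?_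
  · exact div_le_one_of_le₀ (by exact_mod_cast Finset.card_filter_le _ _) hpos.le
  · change ∑ m : Idx n, ((F.filter fun y => y m).card / F.card : ℝ) / ((m : ℕ) : ℝ) ≤ x
    -- Double counting: the constraint value of the marginals is the average reciprocal sum over
    -- `F`.
    have hswap : ∑ y ∈ F, ∑ m : Idx n, (if y m then 1 / ((m : ℕ) : ℝ) else 0)
        = F.card * ∑ m : Idx n, ((F.filter fun y => y m).card / F.card : ℝ) / ((m : ℕ) : ℝ) := by
      rw [Finset.sum_comm, Finset.mul_sum]
      refine Finset.sum_congr rfl fun m _ => ?_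
      rw [← Finset.sum_filter, Finset.sum_const, nsmul_eq_mul]
      field_simp
    have hle : ∑ y ∈ F, ∑ m : Idx n, (if y m then 1 / ((m : ℕ) : ℝ) else 0) ≤ F.card * x := by
      rw [← nsmul_eq_mul]
      exact Finset.sum_le_card_nsmul _ _ _ fun y hy => (Finset.mem_filter.1 hy).2
    rw [hswap] at hle
    exact le_of_mul_le_mul_left hle hpos

/-! ### The lower bound -/

theorem mul_binEntropy_le {s p : ℝ} (hs0 : 0 ≤ s) (hs1 : s ≤ 1) (hp0 : 0 ≤ p) (hp1 : p ≤ 1) :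
    s * Real.binEntropy p ≤ Real.binEntropy (s * p) := by
  have h := Real.strictConcave_binEntropy.concaveOn.2 (x := p) (y := 0) ⟨hp0, hp1⟩
    ⟨le_rfl, zero_le_one⟩ hs0 (sub_nonneg.2 hs1) (add_sub_cancel s 1)
  simpa using h

/-- If a product measure has mean reciprocal sum `x`, variance proxy `V` and entropy `H`, then
scaling its parameters down costs only `2 √V H / x` of the entropy. -/
theorem exp_le_countSubsets_of_profile {n : ℕ} {x : ℝ} (hx : 0 < x) {p : ℕ → ℝ}
    (h0 : ∀ m, 0 ≤ p m) (h1 : ∀ m, p m ≤ 1) (hmean : ∑ m ∈ Finset.Icc 1 n, p m / m = x)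
    (hV : 0 < ∑ m ∈ Finset.Icc 1 n, p m / (m : ℝ) ^ 2) :
    Real.exp ((∑ m ∈ Finset.Icc 1 n, Real.binEntropy (p m))
        - 2 * Real.sqrt (∑ m ∈ Finset.Icc 1 n, p m / (m : ℝ) ^ 2)
          * ((∑ m ∈ Finset.Icc 1 n, Real.binEntropy (p m)) / x)
        - Real.sqrt (32 * n + 1)) / 2
      ≤ countSubsets (Finset.Icc 1 n) x := by
  set H := ∑ m ∈ Finset.Icc 1 n, Real.binEntropy (p m) with hH
  set V := ∑ m ∈ Finset.Icc 1 n, p m / (m : ℝ) ^ 2 with hVdef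
  have hH0 : 0 ≤ H := Finset.sum_nonneg fun m _ => Real.binEntropy_nonneg (h0 m) (h1 m)
  have hσ : 0 < Real.sqrt V := Real.sqrt_pos.2 hV
  -- If `x ≤ 2√V`, the claimed loss exceeds the entropy and the empty set alone suffices. Otherwise
  -- `δ = 2√V/x` is a legitimate scaling, with `τ = δx = 2√V` and `τ² = 4V`.
  rcases le_or_gt x (2 * Real.sqrt V) with hcase | hcase
  · have hone : (1 : ℝ) ≤ countSubsets (Finset.Icc 1 n) x := by
      exact_mod_cast one_le_countSubsets (Finset.Icc 1 n) hx.le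
    have hle : H ≤ 2 * Real.sqrt V * (H / x) := by
      calc H = x * (H / x) := by field_simp
        _ ≤ 2 * Real.sqrt V * (H / x) := by gcongr
    have hexp : Real.exp (H - 2 * Real.sqrt V * (H / x) - Real.sqrt (32 * n + 1)) ≤ 1 :=
      Real.exp_le_one_iff.2 (by linarith [Real.sqrt_nonneg (32 * (n : ℝ) + 1)])
    linarith
  · set δ := 2 * Real.sqrt V / x with hδ
    have hδ0 : 0 ≤ δ := by positivity
    have hδ1 : δ ≤ 1 := (div_le_one hx).2 hcase.le
    have hδx : δ * x = 2 * Real.sqrt V := by rw [hδ]; field_simp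
    have hδH : 2 * Real.sqrt V * (H / x) = δ * H := by rw [hδ]; ring
    have hmain := exp_le_card_of_variance (ι := Idx n) (p := fun m => (1 - δ) * p m)
      (a := fun m => 1 / ((m : ℕ) : ℝ)) (x := x) (τ := δ * x)
      (fun m => mul_nonneg (by linarith) (h0 m))
      (fun m => mul_le_one₀ (by linarith) (h0 m) (h1 m))
      (by rw [hδx]; positivity)
      (by
        rw [Finset.sum_coe_sort (Finset.Icc 1 n) fun m : ℕ => (1 - δ) * p m * (1 / (m : ℝ))]
        have : ∑ m ∈ Finset.Icc 1 n, (1 - δ) * p m * (1 / (m : ℝ)) = (1 - δ) * x := by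
          rw [← hmean, Finset.mul_sum]
          exact Finset.sum_congr rfl fun m _ => by ring
        rw [this]
        linarith)
      (by
        rw [Finset.sum_coe_sort (Finset.Icc 1 n) fun m : ℕ => (1 - δ) * p m * (1 / (m : ℝ)) ^ 2]
        have : ∑ m ∈ Finset.Icc 1 n, (1 - δ) * p m * (1 / (m : ℝ)) ^ 2 = (1 - δ) * V := by
          rw [hVdef, Finset.mul_sum]
          exact Finset.sum_congr rfl fun m _ => by ring
        rw [this, hδx, mul_pow, Real.sq_sqrt hV.le]
        nlinarith)
    rw [← countSubsets_Icc, Fintype.card_coe, Nat.card_Icc, Nat.add_sub_cancel,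
      Finset.sum_coe_sort (Finset.Icc 1 n) fun m : ℕ => Real.binEntropy ((1 - δ) * p m)] at hmain
    refine le_trans ?_ hmain
    have hconc : (1 - δ) * H ≤ ∑ m ∈ Finset.Icc 1 n, Real.binEntropy ((1 - δ) * p m) := by
      rw [hH, Finset.mul_sum]
      exact Finset.sum_le_sum fun m _ =>
        mul_binEntropy_le (by linarith) (by linarith) (h0 m) (h1 m)
    rw [hδH]
    gcongr
    linarith

/-- Weak duality with multiplier `l`: Gibbs' inequality bounds each entropy by an affine function of
the parameter, with equality at the profile, and the profile exhausts the constraint. -/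
theorem sum_binEntropy_optProb_le {n : ℕ} {x l : ℝ} (hx : 0 ≤ x) (hl : 0 ≤ l)
    (hmean : ∑ m ∈ Finset.Icc 1 n, fermi (l / m) / m = x) :
    ∑ m, Real.binEntropy (optProb n x m)
      ≤ ∑ m ∈ Finset.Icc 1 n, Real.binEntropy (fermi (l / m)) := by
  have hfeas : ∑ m : Idx n, (optProb n x m : ℝ) / ((m : ℕ) : ℝ) ≤ x := (optProb_spec n hx).1
  calc ∑ m, Real.binEntropy (optProb n x m)
      ≤ ∑ m : Idx n, (Real.log (1 + Real.exp (-(l / (m : ℕ)))) + l / (m : ℕ) * optProb n x m) :=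
        Finset.sum_le_sum fun m _ =>
          binEntropy_le_of_tilt _ (optProb n x m).2.1 (optProb n x m).2.2
    _ = ∑ m : Idx n, Real.log (1 + Real.exp (-(l / (m : ℕ))))
          + l * ∑ m : Idx n, (optProb n x m : ℝ) / ((m : ℕ) : ℝ) := by
        rw [Finset.sum_add_distrib, Finset.mul_sum]
        congr 1
        exact Finset.sum_congr rfl fun m _ => by ring
    _ ≤ ∑ m : Idx n, Real.log (1 + Real.exp (-(l / (m : ℕ)))) + l * x := by gcongr
    _ = ∑ m ∈ Finset.Icc 1 n, Real.binEntropy (fermi (l / m)) := by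
        rw [Finset.sum_coe_sort (Finset.Icc 1 n) fun m : ℕ =>
          Real.log (1 + Real.exp (-(l / (m : ℝ)))), ← hmean, Finset.mul_sum,
          ← Finset.sum_add_distrib]
        refine Finset.sum_congr rfl fun m _ => ?_
        rw [binEntropy_fermi]
        ring

theorem exp_sum_binEntropy_optProb_le {n : ℕ} {x : ℝ} (hx : 0 < x)
    (hxn : x < Real.log n / 2) :
    Real.exp (∑ m, Real.binEntropy (optProb n x m) - 43 * Real.sqrt (n * Real.exp (2 * x)))
      ≤ countSubsets (Finset.Icc 1 n) x := by
  obtain ⟨l, hl, hmean⟩ := exists_sum_fermi_eq hx hxn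
  have hn : 1 ≤ n := by
    rcases Nat.eq_zero_or_pos n with rfl | h
    · simp at hxn; linarith
    · exact h
  have hn' : (1 : ℝ) ≤ n := by exact_mod_cast hn
  set V := ∑ m ∈ Finset.Icc 1 n, fermi (l / m) / (m : ℝ) ^ 2
  set H := ∑ m ∈ Finset.Icc 1 n, Real.binEntropy (fermi (l / m))
  set R := Real.sqrt (n * Real.exp (2 * x))
  have hnR : (n : ℝ) ≤ n * Real.exp (2 * x) :=
    le_mul_of_one_le_right n.cast_nonneg (Real.one_le_exp (by linarith))
  have hR1 : 1 ≤ R := Real.one_le_sqrt.2 (hn'.trans hnR)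
  have hV : 0 < V := Finset.sum_pos (fun m hm => by
    have := fermi_pos (l / m)
    have : (0 : ℝ) < m := by exact_mod_cast (Finset.mem_Icc.1 hm).1
    positivity) ⟨1, by simp [hn]⟩
  have hprof := exp_le_countSubsets_of_profile hx (p := fun m : ℕ => fermi (l / m))
    (fun m => (fermi_pos _).le) (fun m => (fermi_lt_one _).le) hmean hV
  refine le_trans ?_ hprof
  have hopt := sum_binEntropy_optProb_le hx.le hl.le hmean
  have hHx : H / x ≤ 2 * n + l := (div_le_iff₀ hx).2 (sum_binEntropy_fermi_le hl hmean)
  have hloss : Real.sqrt V * (H / x) ≤ 18 * R := by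
    calc Real.sqrt V * (H / x) ≤ Real.sqrt V * (2 * n + l) := by gcongr
      _ = Real.sqrt ((2 * n + l) ^ 2 * V) := by
          rw [Real.sqrt_mul (sq_nonneg _), Real.sqrt_sq (by positivity), mul_comm]
      _ ≤ Real.sqrt (18 ^ 2 * (n * Real.exp (2 * x))) :=
          Real.sqrt_le_sqrt (sq_mul_sum_fermi_le hl hmean hx.le)
      _ = 18 * R := by rw [Real.sqrt_mul (sq_nonneg _), Real.sqrt_sq (by norm_num)]
  have hfluct : Real.sqrt (32 * n + 1) ≤ 6 * R := by
    calc Real.sqrt (32 * n + 1) ≤ Real.sqrt (6 ^ 2 * (n * Real.exp (2 * x))) :=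
          Real.sqrt_le_sqrt (by linarith)
      _ = 6 * R := by rw [Real.sqrt_mul (sq_nonneg _), Real.sqrt_sq (by norm_num)]
  have hhalf : ∀ t : ℝ, Real.exp t / 2 = Real.exp (t - Real.log 2) := fun t => by
    rw [Real.exp_sub, Real.exp_log two_pos]
  rw [hhalf]
  have hlog2 : Real.log 2 ≤ 1 := by linarith [Real.log_two_lt_d9]
  -- The constant is `43 = 2·18 + 6 + 1`: scaling, fluctuation, and the factor `1/2` through `log 2
  -- ≤ 1 ≤ R`.
  exact Real.exp_le_exp.2 (by linarith)

end EgyptianEntropy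

end

/-! ### Assembly -/

theorem lemma2p1 :
    (∀ ε : ℝ, 0 < ε → ∀ (n : ℕ) (x : ℝ), 0 < x → x < (1 - ε) * Real.log n / 2 →
      (EgyptianEntropy.countSubsets (Finset.Icc 1 n) x : ℝ)
        ≤ (2 : ℝ) ^ EgyptianEntropy.shannonEntropy (EgyptianEntropy.P n x)) ∧
    (∃ C : ℝ, 0 < C ∧ ∃ K : ℝ, 0 < K ∧ ∃ c : ℝ → ℕ → ℝ,
      ∀ ε : ℝ, 0 < ε → ∀ (n : ℕ) (x : ℝ), 0 < x → x < (1 - ε) * Real.log n / 2 →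
        0 < c x n ∧
        C⁻¹ * Real.exp (-2 * x) ≤ c x n ∧ c x n ≤ C * Real.exp (-2 * x) ∧
        ∀ U : Finset ℕ, U ⊆ Finset.Icc 1 n →
          (2 : ℝ) ^ (EgyptianEntropy.shannonEntropy (EgyptianEntropy.P n x)
              - ((n : ℝ) - (U.card : ℝ)) - K * Real.sqrt ((n : ℝ) / c x n))
            ≤ (EgyptianEntropy.countSubsets U x : ℝ)) := by
  -- The choice `c = e^{-2x}` allows `C = 1`; dividing `43` by `log 2` converts nats to bits.
  refine ⟨fun ε _ n x hx _ => EgyptianEntropy.countSubsets_le_two_rpow_entropy hx.le n,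
    1, one_pos, 43 / Real.log 2, div_pos (by norm_num) (Real.log_pos one_lt_two),
    fun x _ => Real.exp (-2 * x), ?_⟩
  intro ε hε n x hx hxn
  refine ⟨Real.exp_pos _, by simp, by simp, fun U hU => ?_⟩
  have hxn' : x < Real.log n / 2 := by
    have := mul_nonneg hε.le (Real.log_natCast_nonneg n)
    linarith
  have hdiv : (n : ℝ) / Real.exp (-2 * x) = n * Real.exp (2 * x) := by
    rw [neg_mul, Real.exp_neg, div_inv_eq_mul]
  have hcard : U.card ≤ n := by simpa using Finset.card_le_card hU
  have hfull := EgyptianEntropy.exp_sum_binEntropy_optProb_le hx hxn'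
  have hres : (EgyptianEntropy.countSubsets (Finset.Icc 1 n) x : ℝ)
      ≤ 2 ^ (n - U.card) * EgyptianEntropy.countSubsets U x := by
    have := EgyptianEntropy.countSubsets_le_two_pow_mul hU x
    rw [Nat.card_Icc, Nat.add_sub_cancel] at this
    exact_mod_cast this
  rw [hdiv, EgyptianEntropy.shannonEntropy_P, EgyptianEntropy.sum_h_eq, sub_right_comm,
    div_mul_eq_mul_div, ← sub_div, Real.rpow_sub two_pos, EgyptianEntropy.two_rpow_div_log_two,
    ← Nat.cast_sub hcard, Real.rpow_natCast, div_le_iff₀ (by positivity), mul_comm (EgyptianEntropy.countSubsets U x : ℝ)]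
  exact hfull.trans hres
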